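/- For a locally finite graph $G$ with vertex set $V$ (no loops or multiple edges), let $\Delta f(x)=\sum_{y\sim x}(f(x)-f(y))$. For a finite set $D\subset V$ let $\Delta_D$ be the compression of $\Delta$ to functions supported in $D$ (Dirichlet boundary conditions; the diagonal entries are the valences in $G$), let $p^D_t(x,y)$ be the kernel of $e^{-t\Delta_D}$, extended by $0$ outside $D\times D$, and let the heat kernel $p_t(x,y)=\sup_D p_t^D(x,y)$ be the limit of these kernels along exhaustions of $V$ by finite sets. The graph is *stochastically incomplete* if $\sum_{y\in V}p_t(x,y)<1$ for some $t>0$ and some $x\in V$, and *stochastically complete* otherwise. For a fixed vertex $x_0$ of a connected graph, let $S_r$ be the set of vertices at distance $r$ from $x_0$, $S(r)=|S_r|$ and $V(r)=\sum_{i=0}^r S(i)$. For a vertex $x\in S_r$ let $m_\pm(x)$ be the number of neighbors of $x$ in $S_{r\pm1}$. The graph is *spherically symmetric* about $x_0$ if $m_\pm(x)$ depend only on the distance $r$ of $x$ from $x_0$; the common values are then denoted $k_\pm(r)$. Given $S:\{0,1,2,\dots\}\to\{1,2,3,\dots\}$ with $S(0)=1$, let $G_S$ be the graph whose vertex set is a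 disjoint union of layers $L_0,L_1,\dots$ with $|L_r|=S(r)$, in which two vertices are adjacent if and only if they lie in consecutive layers; let $x_0$ be the vertex in $L_0$. 1. In $G_S$ the sphere $S_r$ has $S(r)$ vertices for every $r\ge 0$. The graph $G_S$ is spherically symmetric about $x_0$ with $k_+(r)=S(r+1)$ for $r\ge 0$, $k_-(r)=S(r-1)$ for $r\ge1$ and $k_-(0)=0$. It is stochastically incomplete if and only if $$\sum_{r=0}^\infty \frac{V(r)}{S(r)\,S(r+1)}<\infty .$$ 2. For $S(r)=(r+1)^3$ the graph $G_S$ is stochastically incomplete, and it has polynomial volume growth $V(r)=\frac{(r+1)^2(r+2)^2}{4}$ for all $r\ge 0$. 3. Consequently the analogue for graphs of Grigor'yan's volume criterion is false: it is not true that every infinite, connected, locally finite graph that satisfies $$\int_1^\infty \frac{r}{\log V(r)}\,dr=\infty$$ for a vertex $x_0$ (where, for real $r$, $V(r)=V(\lfloor r\rfloor)$ is the number of vertices at distance at most $r$ from $x_0$) is stochastically complete. 4. For $S(r)=(r+1)^2$ one has $k_+(r)=(r+2)^2$ and $k_-(r)=r^2$, so that $\sum_{r=0}^\infty 1/k_+(r)<\infty$,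 but $G_S$ is stochastically complete. 5. Let $G$ be an infinite, connected, locally finite graph with a vertex $x_0$ such that $\sum_{r=0}^\infty \frac{V(r)}{S(r)S(r+1)}<\infty$. Then the graph obtained from $G$ by joining every vertex of $S_r$ to every vertex of $S_{r+1}$ for all $r\ge 0$ (keeping all edges of $G$) is spherically symmetric about $x_0$ and stochastically incomplete. -/

import Mathlib

open MeasureTheory Set
open scoped ENNReal

namespace SimpleGraph

/-- The Dirichlet Laplacian of a finite set `D` of vertices, as a matrix: the compression to
functions supported in `D` of `Δ f x = m x * f x - ∑ y ∼ x, f y`. The number `m x` is the valence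
of `x` in the whole graph `G`, not in the subgraph induced on `D`. -/
noncomputable def dirichletLaplacian {V : Type*} (G : SimpleGraph V) (D : Finset V) :
    Matrix D D ℝ := by
  classical
  exact fun x y =>
    if x = y then ((G.neighborSet (x : V)).ncard : ℝ)
    else if G.Adj (x : V) (y : V) then -1 else 0

/-- The Dirichlet heat kernel of a finite set `D` of vertices: the kernel of the operator
`exp (-t Δ_D)`, extended by zero outside of `D × D`. -/
noncomputable def dirichletHeatKernel {V : Type*} (G : SimpleGraph V) (D : Finset V)
    (t : ℝ) (x y : V) : ℝ := by
  classical
  exact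
    if h : x ∈ D ∧ y ∈ D then
      NormedSpace.exp ((-t) • G.dirichletLaplacian D) ⟨x, h.1⟩ ⟨y, h.2⟩
    else 0

/-- The (minimal) heat kernel `p_t(x, y)`, constructed by exhaustion: the Dirichlet heat kernels
are nonnegative and increase with the finite set `D`, so that their limit along any exhaustion
by finite sets is their supremum over all finite sets. -/
noncomputable def heatKernel {V : Type*} (G : SimpleGraph V) (t : ℝ) (x y : V) : ℝ≥0∞ :=
  ⨆ D : Finset V, ENNReal.ofReal (G.dirichletHeatKernel D t x y)

/-- The minimal diffusion loses mass: `∑ y, p_t(x, y) < 1` for some `t > 0` and some `x`. -/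
def StochasticallyIncomplete {V : Type*} (G : SimpleGraph V) : Prop :=
  ∃ t : ℝ, 0 < t ∧ ∃ x : V, ∑' y : V, G.heatKernel t x y < 1

/-- The number of vertices at distance `r` from `x₀`. -/
noncomputable def sphereArea {V : Type*} (G : SimpleGraph V) (x₀ : V) (r : ℕ) : ℕ :=
  {x : V | G.dist x x₀ = r}.ncard

/-- The volume of the ball of radius `r` about `x₀`. -/
noncomputable def ballVolume {V : Type*} (G : SimpleGraph V) (x₀ : V) (r : ℕ) : ℕ :=
  ∑ i ∈ Finset.range (r + 1), G.sphereArea x₀ i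

/-- `G` is spherically symmetric about `x₀`: a vertex at distance `r` from `x₀` has exactly
`kp r` neighbors at distance `r + 1` and exactly `km r` neighbors at distance `r - 1`. -/
def IsSphericallySymmetricWith {V : Type*} (G : SimpleGraph V) (x₀ : V) (kp km : ℕ → ℕ) : Prop :=
  ∀ x : V,
    {y : V | G.Adj x y ∧ G.dist y x₀ = G.dist x x₀ + 1}.ncard = kp (G.dist x x₀) ∧
    {y : V | G.Adj x y ∧ G.dist y x₀ + 1 = G.dist x x₀}.ncard = km (G.dist x x₀)

/-- The graph `G_S`: its `r`-th layer has `S r` vertices, and two vertices are adjacent exactly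
when they lie in consecutive layers. -/
def layeredGraph (S : ℕ → ℕ) : SimpleGraph (Σ r : ℕ, Fin (S r)) where
  Adj x y := x.1 + 1 = y.1 ∨ y.1 + 1 = x.1
  symm := ⟨fun _ _ h => h.symm⟩
  loopless := ⟨fun _ h => by omega⟩

/-- The unique vertex of `G_S` in layer `0`. -/
def layeredRoot (S : ℕ → ℕ) (h0 : S 0 = 1) : Σ r : ℕ, Fin (S r) :=
  ⟨0, ⟨0, by omega⟩⟩

/-- The graph obtained from `G` by adding all edges between a vertex at distance `r` and a vertex
at distance `r + 1` from `x₀`, for all `r`. -/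
def joinSpheres {V : Type*} (G : SimpleGraph V) (x₀ : V) : SimpleGraph V where
  Adj x y := G.Adj x y ∨ G.dist x x₀ + 1 = G.dist y x₀ ∨ G.dist y x₀ + 1 = G.dist x x₀
  symm := ⟨fun _ _ h => h.elim (fun h => Or.inl h.symm) (fun h => Or.inr h.symm)⟩
  loopless := ⟨fun x h => by
    rcases h with h | h | h
    · exact G.irrefl h
    · omega
    · omega⟩

/-- Grigor'yan's volume growth condition `∫^∞ r / log V(r) dr = ∞`, where `V(r)` is the number
of vertices at distance at most `r` from `x₀`. In an infinite, connected, locally finite graph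
`V(r) ≥ 2` for `r ≥ 1`, and the integrand is positive and locally bounded on `[1, ∞)`. -/
def GrigoryanVolumeCondition {V : Type*} (G : SimpleGraph V) (x₀ : V) : Prop :=
  ∫⁻ r in Ioi (1 : ℝ), ENNReal.ofReal (r / Real.log (G.ballVolume x₀ ⌊r⌋₊ : ℝ)) = ⊤

end SimpleGraph

/-! ### Exponentials of matrices with nonnegative off-diagonal entries. -/

namespace Matrix

variable {m n : Type*} [Fintype m] [DecidableEq m] [Fintype n] [DecidableEq n]

/-! Two comparison principles decide everything. If `h ≥ 0` and `Δh ≥ 1`, the mass at time `t` is at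
most `h x / t`. If `h ≥ 0` is proper and `Δh ≥ -1`, the mass is at least `1 - (h x + t) / H` for
every `H > h x`, hence at least `1`. Both follow from Duhamel monotonicity on finite sets
(`le_exp_mulVec_of_affine`), because `-Δ_D` has nonnegative off-diagonal entries.

When consecutive spheres are completely joined, one radial function serves both: `P(n) = ∑_{i<n}
V(i) / (S(i) S(i+1))`. There are `S(r) S(r+1)` edges between `S_r` and `S_{r+1}`, so the flux of `P`
between them is `V(r)`, and `ΔP = -1` at every vertex. If the series diverges, `P` is proper; if it
converges, its tail is nonnegative with Laplacian `1`.

The terms of the series are of order `1/r²` for cubic layers and `1/r` for quadratic ones. Joining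
the spheres of a graph preserves distances to the root, and edges inside a sphere do not affect
radial functions, so the same criterion applies. -/

theorem hasSum_exp_apply (M : Matrix m m ℝ) (i j : m) :
    HasSum (fun k : ℕ => ((k.factorial : ℝ)⁻¹) * (M ^ k) i j) (NormedSpace.exp M i j) := by
  let : NormedRing (Matrix m m ℝ) := Matrix.linftyOpNormedRing
  let : NormedAlgebra ℝ (Matrix m m ℝ) := Matrix.linftyOpNormedAlgebra
  have h := NormedSpace.exp_series_hasSum_exp' (𝕂 := ℝ) M
  exact Pi.hasSum.1 (Pi.hasSum.1 h i) j

theorem hasDerivAt_exp_smul_apply (M : Matrix m m ℝ) (t : ℝ) (i j : m) :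
    HasDerivAt (fun s : ℝ => NormedSpace.exp (s • M) i j)
      ((NormedSpace.exp (t • M) * M) i j) t := by
  let : NormedRing (Matrix m m ℝ) := Matrix.linftyOpNormedRing
  let : NormedAlgebra ℝ (Matrix m m ℝ) := Matrix.linftyOpNormedAlgebra
  have h := hasDerivAt_exp_smul_const (𝕂 := ℝ) M t
  exact hasDerivAt_pi.1 (hasDerivAt_pi.1 h i) j

theorem exp_add_smul_one (M : Matrix m m ℝ) (c : ℝ) :
    NormedSpace.exp (M + c • (1 : Matrix m m ℝ)) = Real.exp c • NormedSpace.exp M := by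
  rw [exp_add_of_commute _ _ ((Commute.one_right M).smul_right c)]
  have h : c • (1 : Matrix m m ℝ) = diagonal fun _ => c := by
    ext i j; simp [Matrix.one_apply, Matrix.diagonal_apply]
  rw [h, exp_diagonal]
  ext i j
  simp [Matrix.mul_diagonal, Real.exp_eq_exp_ℝ, Pi.coe_exp, mul_comm]

/-- Entries of a power are sums over paths of products of nonnegative weights, and `f` carries the
paths in `m` injectively to some of the paths in `n`. -/
theorem pow_apply_le_of_embedding {M : Matrix m m ℝ} {N : Matrix n n ℝ} (f : m ↪ n)
    (hM : ∀ i j, 0 ≤ M i j) (hN : ∀ i j, 0 ≤ N i j) (hMN : ∀ i j, M i j ≤ N (f i) (f j))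
    (k : ℕ) (i j : m) : (M ^ k) i j ≤ (N ^ k) (f i) (f j) := by
  induction k generalizing i j with
  | zero => simp [Matrix.one_apply]
  | succ k ih =>
    rw [pow_succ, pow_succ, Matrix.mul_apply, Matrix.mul_apply]
    calc ∑ l, (M ^ k) i l * M l j ≤ ∑ l, (N ^ k) (f i) (f l) * N (f l) (f j) :=
          Finset.sum_le_sum fun l _ => mul_le_mul (ih i l) (hMN l j) (hM l j)
            (pow_apply_nonneg hN k _ _)
      _ = ∑ l ∈ Finset.univ.map f, (N ^ k) (f i) l * N l (f j) := by rw [Finset.sum_map]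
      _ ≤ ∑ l, (N ^ k) (f i) l * N l (f j) :=
          Finset.sum_le_sum_of_subset_of_nonneg (Finset.subset_univ _) fun l _ _ =>
            mul_nonneg (pow_apply_nonneg hN k _ _) (hN l _)

/-- Reduces sign questions to entrywise nonnegative matrices, where the exponential series can be
compared term by term. -/
theorem exp_apply_eq_shift (M : Matrix m m ℝ) (c : ℝ) (i j : m) :
    NormedSpace.exp M i j =
      Real.exp (-c) * NormedSpace.exp (M + c • (1 : Matrix m m ℝ)) i j := by
  rw [exp_add_smul_one, Matrix.smul_apply, smul_eq_mul, ← mul_assoc, ← Real.exp_add]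
  simp

theorem add_smul_one_apply_nonneg {M : Matrix m m ℝ} (hM : ∀ i j, i ≠ j → 0 ≤ M i j) {c : ℝ}
    (hc : ∑ i, |M i i| ≤ c) (i j : m) : 0 ≤ (M + c • (1 : Matrix m m ℝ)) i j := by
  by_cases h : i = j
  · subst h
    have h1 : |M i i| ≤ ∑ i, |M i i| :=
      Finset.single_le_sum (f := fun i => |M i i|) (fun _ _ => abs_nonneg _) (Finset.mem_univ i)
    have h2 := neg_abs_le (M i i)
    simp only [Matrix.add_apply, Matrix.smul_apply, Matrix.one_apply_eq, smul_eq_mul, mul_one]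
    linarith
  · simpa [Matrix.one_apply_ne h] using hM i j h

/-- The exponential of a matrix with nonnegative off-diagonal entries is nonnegative. -/
theorem exp_apply_nonneg {M : Matrix m m ℝ} (hM : ∀ i j, i ≠ j → 0 ≤ M i j) (i j : m) :
    0 ≤ NormedSpace.exp M i j := by
  rw [exp_apply_eq_shift M (∑ i, |M i i|)]
  refine mul_nonneg (Real.exp_pos _).le ((hasSum_exp_apply _ i j).nonneg fun k => ?_)
  exact mul_nonneg (by positivity) (pow_apply_nonneg (add_smul_one_apply_nonneg hM le_rfl) k i j)

/-- Domain monotonicity of the exponential of matrices with nonnegative off-diagonal entries. -/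
theorem exp_apply_le_of_embedding {M : Matrix m m ℝ} {N : Matrix n n ℝ} (f : m ↪ n)
    (hM : ∀ i j, i ≠ j → 0 ≤ M i j) (hN : ∀ i j, i ≠ j → 0 ≤ N i j)
    (hMN : ∀ i j, M i j ≤ N (f i) (f j)) (i j : m) :
    NormedSpace.exp M i j ≤ NormedSpace.exp N (f i) (f j) := by
  -- A common shift makes both matrices nonnegative and preserves the comparison between them.
  set c := ∑ i, |M i i| + ∑ i, |N i i|
  have hcM : ∑ i, |M i i| ≤ c := le_add_of_nonneg_right (Finset.sum_nonneg fun _ _ => abs_nonneg _)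
  have hcN : ∑ i, |N i i| ≤ c := le_add_of_nonneg_left (Finset.sum_nonneg fun _ _ => abs_nonneg _)
  rw [exp_apply_eq_shift M c, exp_apply_eq_shift N c]
  refine mul_le_mul_of_nonneg_left ?_ (Real.exp_pos _).le
  refine hasSum_le (fun k => ?_) (hasSum_exp_apply _ i j) (hasSum_exp_apply _ (f i) (f j))
  refine mul_le_mul_of_nonneg_left ?_ (by positivity)
  refine pow_apply_le_of_embedding f (add_smul_one_apply_nonneg hM hcM)
    (add_smul_one_apply_nonneg hN hcN) (fun i j => ?_) k i j
  have := hMN i j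
  simp only [Matrix.add_apply, Matrix.smul_apply, Matrix.one_apply, f.injective.eq_iff]
  linarith

/-- Duhamel comparison: if the affine path `s ↦ a + s b` satisfies `(a + s b)' + M (a + s b) ≥ 0`
on `[0, t]`, then `exp (t M)` maps its end point above its starting point. -/
theorem le_exp_mulVec_of_affine {M : Matrix m m ℝ} (hM : ∀ i j, i ≠ j → 0 ≤ M i j)
    (a b : m → ℝ) {t : ℝ} (ht : 0 ≤ t)
    (h : ∀ s ∈ Icc 0 t, ∀ i, 0 ≤ b i + (M *ᵥ (a + s • b)) i) (i : m) :
    a i ≤ (NormedSpace.exp (t • M) *ᵥ (a + t • b)) i := by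
  -- Since `exp (s M)` commutes with `M`, the derivative is `exp (s M)` applied to the vector that
  -- the hypothesis makes nonnegative.
  have hderiv : ∀ s : ℝ, HasDerivAt (fun s : ℝ => (NormedSpace.exp (s • M) *ᵥ (a + s • b)) i)
      ((NormedSpace.exp (s • M) *ᵥ (b + M *ᵥ (a + s • b))) i) s := by
    intro s
    have h1 : ∀ j, HasDerivAt (fun s : ℝ => NormedSpace.exp (s • M) i j * (a j + s * b j))
        ((NormedSpace.exp (s • M) * M) i j * (a j + s * b j) +
          NormedSpace.exp (s • M) i j * b j) s := fun j => by
      have h2 : HasDerivAt (fun s : ℝ => a j + s * b j) (b j) s := by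
        simpa using ((hasDerivAt_id s).mul_const (b j)).const_add (a j)
      exact (hasDerivAt_exp_smul_apply M s i j).mul h2
    have h3 := HasDerivAt.fun_sum (u := Finset.univ) fun j _ => h1 j
    refine h3.congr_deriv ?_
    symm
    rw [Matrix.mulVec_add, Matrix.mulVec_mulVec, Finset.sum_add_distrib, add_comm]
    rfl
  have hmono : MonotoneOn (fun s : ℝ => (NormedSpace.exp (s • M) *ᵥ (a + s • b)) i)
      (Icc 0 t) := by
    refine monotoneOn_of_hasDerivWithinAt_nonneg (convex_Icc 0 t)
      (fun s _ => (hderiv s).continuousAt.continuousWithinAt)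
      (fun s _ => (hderiv s).hasDerivWithinAt) fun s hs => ?_
    have hs' := interior_subset hs
    refine Finset.sum_nonneg fun j _ => mul_nonneg (exp_apply_nonneg ?_ i j) (h s hs' j)
    exact fun i j hij => mul_nonneg hs'.1 (hM i j hij)
  have := hmono (left_mem_Icc.2 ht) (right_mem_Icc.2 ht) ht
  simpa [NormedSpace.exp_zero] using this

end Matrix

/-! ### Dirichlet heat kernels and their monotonicity. -/

namespace SimpleGraph

open scoped Matrix

variable {V : Type*} {G : SimpleGraph V}

open Classical in
theorem dirichletLaplacian_apply (D : Finset V) (x y : D) :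
    G.dirichletLaplacian D x y = if x = y then ((G.neighborSet (x : V)).ncard : ℝ)
      else if G.Adj (x : V) (y : V) then -1 else 0 := rfl

theorem neg_dirichletLaplacian_apply_nonneg (D : Finset V) (x y : D) (h : x ≠ y) :
    0 ≤ (-G.dirichletLaplacian D) x y := by
  rw [Matrix.neg_apply, dirichletLaplacian_apply, if_neg h]
  split_ifs <;> norm_num

open Classical in
theorem dirichletHeatKernel_of_mem {D : Finset V} {x y : V} (t : ℝ) (hx : x ∈ D) (hy : y ∈ D) :
    G.dirichletHeatKernel D t x y =
      NormedSpace.exp (t • -G.dirichletLaplacian D) ⟨x, hx⟩ ⟨y, hy⟩ := by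
  rw [dirichletHeatKernel, dif_pos ⟨hx, hy⟩, neg_smul, smul_neg]

theorem dirichletHeatKernel_of_notMem {D : Finset V} {x y : V} (t : ℝ) (h : ¬(x ∈ D ∧ y ∈ D)) :
    G.dirichletHeatKernel D t x y = 0 := by
  rw [dirichletHeatKernel, dif_neg h]

theorem dirichletHeatKernel_nonneg (D : Finset V) {t : ℝ} (ht : 0 ≤ t) (x y : V) :
    0 ≤ G.dirichletHeatKernel D t x y := by
  classical
  by_cases h : x ∈ D ∧ y ∈ D
  · rw [dirichletHeatKernel_of_mem t h.1 h.2]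
    exact Matrix.exp_apply_nonneg (fun i j hij =>
      mul_nonneg ht (neg_dirichletLaplacian_apply_nonneg D i j hij)) _ _
  · rw [dirichletHeatKernel_of_notMem t h]

theorem dirichletHeatKernel_mono {D E : Finset V} (hDE : D ⊆ E) {t : ℝ} (ht : 0 ≤ t) (x y : V) :
    G.dirichletHeatKernel D t x y ≤ G.dirichletHeatKernel E t x y := by
  classical
  by_cases h : x ∈ D ∧ y ∈ D
  · rw [dirichletHeatKernel_of_mem t h.1 h.2, dirichletHeatKernel_of_mem t (hDE h.1) (hDE h.2)]
    obtain ⟨ι, hι⟩ : ∃ ι : D ↪ E, ∀ z, (ι z : V) = z :=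
      ⟨⟨fun z => ⟨z, hDE z.2⟩, fun z w hzw => Subtype.ext (by simpa using hzw)⟩, fun _ => rfl⟩
    rw [show (⟨x, hDE h.1⟩ : E) = ι ⟨x, h.1⟩ from Subtype.ext (hι ⟨x, h.1⟩).symm,
      show (⟨y, hDE h.2⟩ : E) = ι ⟨y, h.2⟩ from Subtype.ext (hι ⟨y, h.2⟩).symm]
    refine Matrix.exp_apply_le_of_embedding ι
      (fun i j hij => mul_nonneg ht (neg_dirichletLaplacian_apply_nonneg D i j hij))
      (fun i j hij => mul_nonneg ht (neg_dirichletLaplacian_apply_nonneg E i j hij))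
      (fun i j => le_of_eq ?_) _ _
    simp only [Matrix.neg_apply, dirichletLaplacian_apply, hι, ι.injective.eq_iff]
  · rw [dirichletHeatKernel_of_notMem t h]
    exact dirichletHeatKernel_nonneg E ht x y

open Classical in
theorem sum_dirichletHeatKernel_mul {D : Finset V} {x : V} (t : ℝ) (hx : x ∈ D) (f : V → ℝ) :
    ∑ y ∈ D, G.dirichletHeatKernel D t x y * f y =
      (NormedSpace.exp (t • -G.dirichletLaplacian D) *ᵥ fun y : D => f y) ⟨x, hx⟩ := by
  rw [← Finset.sum_coe_sort]
  exact Finset.sum_congr rfl fun y _ => by rw [dirichletHeatKernel_of_mem t hx y.2]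

open Classical in
-- The compression replaces `f` by `0` outside `D` but keeps the full valence, so it exceeds the
-- Laplacian of `f` by the values at outer neighbors. The sign of this boundary term drives both
-- comparisons below.
theorem dirichletLaplacian_mulVec (hG : ∀ x, (G.neighborSet x).Finite) (D : Finset V)
    (f : V → ℝ) (x : D) :
    (G.dirichletLaplacian D *ᵥ fun y : D => f y) x =
      ∑ y ∈ (hG x).toFinset, (f x - f y) +
        ∑ y ∈ (hG x).toFinset with y ∉ (D : Set V), f y := by
  classical
  have h1 : ∀ y : D, G.dirichletLaplacian D x y * f y =
      (if y = x then ((G.neighborSet (x : V)).ncard : ℝ) * f x else 0) -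
        if G.Adj (x : V) (y : V) then f y else 0 := by
    intro y
    rw [dirichletLaplacian_apply]
    by_cases h : x = y
    · subst h; simp
    · rw [if_neg h, if_neg (Ne.symm h)]; split_ifs <;> simp
  have h2 : ∑ y : D, (if G.Adj (x : V) (y : V) then f y else 0) =
      ∑ y ∈ (hG x).toFinset with y ∈ (D : Set V), f y := by
    rw [Finset.sum_coe_sort D fun y => if G.Adj (x : V) y then f y else 0, ← Finset.sum_filter]
    refine Finset.sum_congr ?_ fun _ _ => rfl
    ext y
    simp [and_comm]
  calc (G.dirichletLaplacian D *ᵥ fun y : D => f y) x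
      = ∑ y : D, G.dirichletLaplacian D x y * f y := rfl
    _ = (G.neighborSet (x : V)).ncard * f x -
          ∑ y ∈ (hG x).toFinset with y ∈ (D : Set V), f y := by
        rw [Finset.sum_congr rfl fun y _ => h1 y, Finset.sum_sub_distrib, h2,
          Finset.sum_ite_eq' Finset.univ x, if_pos (Finset.mem_univ x)]
    _ = _ := by
        rw [Finset.sum_sub_distrib, Finset.sum_const, nsmul_eq_mul,
          Set.ncard_eq_toFinset_card _ (hG x),
          ← Finset.sum_filter_add_sum_filter_not (hG x).toFinset (fun y => y ∈ (D : Set V)) f]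
        ring

/-! ### Comparison criteria for loss and conservation of mass. -/

/-- A graph with a nonnegative function whose Laplacian is at least `1` is stochastically
incomplete: the function dominates the expected life time of the minimal diffusion. -/
theorem stochasticallyIncomplete_of_one_le_laplacian [Nonempty V]
    (hG : ∀ x, (G.neighborSet x).Finite) (h : V → ℝ) (h0 : ∀ x, 0 ≤ h x)
    (hΔ : ∀ x, 1 ≤ ∑ y ∈ (hG x).toFinset, (h x - h y)) : G.StochasticallyIncomplete := by
  classical
  obtain ⟨x⟩ := ‹Nonempty V›
  -- Any `t > h x` would do, as the mass at time `t` is at most `h x / t`.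
  set t := h x + 1
  have ht : 0 < t := by linarith [h0 x]
  refine ⟨t, ht, x, ?_⟩
  have key : ∀ D : Finset V, ∑ y ∈ D, G.dirichletHeatKernel D t x y ≤ h x / t := by
    intro D
    by_cases hx : x ∈ D
    -- The path `-h - s` is nonpositive outside `D`, so the boundary term helps. Its endpoints give
    -- `exp (-t Δ_D) (h + t) ≤ h`, and dropping `h ≥ 0` on the left leaves `t` times the mass.
    · have hcmp := Matrix.le_exp_mulVec_of_affine (M := -G.dirichletLaplacian D)
        (neg_dirichletLaplacian_apply_nonneg D) (fun y => -h y) (fun _ => -1) ht.le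
        (fun s hs z => by
          have e : ((fun y : D => -h y) + s • fun _ : D => (-1 : ℝ)) =
              fun y : D => (fun y : V => -h y - s) y := by
            ext y; simp; ring
          rw [e, Matrix.neg_mulVec, Pi.neg_apply,
            dirichletLaplacian_mulVec hG D (fun y : V => -h y - s) z]
          have h1 := hΔ z
          have h2 : ∑ y ∈ (hG z).toFinset, ((-h z - s) - (-h y - s)) =
              -∑ y ∈ (hG z).toFinset, (h z - h y) := by
            rw [← Finset.sum_neg_distrib]
            exact Finset.sum_congr rfl fun y _ => by ring
          have h3 : ∑ y ∈ (hG z).toFinset with y ∉ (D : Set V), (-h y - s) ≤ 0 :=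
            Finset.sum_nonpos fun y _ => by linarith [h0 y, hs.1]
          linarith) ⟨x, hx⟩
      have e : ((fun y : D => -h y) + t • fun _ : D => (-1 : ℝ)) =
              fun y : D => (fun y : V => -h y - t) y := by
            ext y; simp; ring
      rw [e, ← sum_dirichletHeatKernel_mul t hx (fun y : V => -h y - t)] at hcmp
      have h4 : ∑ y ∈ D, G.dirichletHeatKernel D t x y * (-h y - t) ≤
          ∑ y ∈ D, G.dirichletHeatKernel D t x y * (-t) :=
        Finset.sum_le_sum fun y _ => mul_le_mul_of_nonneg_left (by linarith [h0 y])
          (dirichletHeatKernel_nonneg D ht.le x y)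
      rw [← Finset.sum_mul] at h4
      rw [le_div_iff₀ ht]
      linarith
    · rw [Finset.sum_eq_zero fun y _ => dirichletHeatKernel_of_notMem t fun hh => hx hh.1]
      exact div_nonneg (h0 x) ht.le
  have hlt : ENNReal.ofReal (h x / t) < 1 := by
    rw [ENNReal.ofReal_lt_one, div_lt_one ht]
    exact lt_add_one _
  refine lt_of_le_of_lt ?_ hlt
  rw [ENNReal.tsum_eq_iSup_sum]
  refine iSup_le fun F => ?_
  unfold heatKernel
  rw [ENNReal.finsetSum_iSup_of_monotone fun y D E hDE =>
    ENNReal.ofReal_le_ofReal (dirichletHeatKernel_mono hDE ht.le x y)]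
  refine iSup_le fun D => ?_
  rw [← ENNReal.ofReal_sum_of_nonneg fun y _ => dirichletHeatKernel_nonneg D ht.le x y]
  refine ENNReal.ofReal_le_ofReal ?_
  -- The summation set `F` and the Dirichlet domain `D` are independent; enlarging both to `F ∪ D`
  -- only increases the sum.
  have hFD := key (F ∪ D)
  refine le_trans ?_ hFD
  calc ∑ y ∈ F, G.dirichletHeatKernel D t x y
      ≤ ∑ y ∈ F ∪ D, G.dirichletHeatKernel D t x y :=
        Finset.sum_le_sum_of_subset_of_nonneg Finset.subset_union_left fun y _ _ =>
          dirichletHeatKernel_nonneg D ht.le x y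
    _ ≤ ∑ y ∈ F ∪ D, G.dirichletHeatKernel (F ∪ D) t x y :=
        Finset.sum_le_sum fun y _ =>
          dirichletHeatKernel_mono Finset.subset_union_right ht.le x y

/-- Khas'minskii's criterion: a graph with a nonnegative function that tends to infinity and whose
Laplacian is at least `-1` is stochastically complete. -/
theorem not_stochasticallyIncomplete_of_neg_one_le_laplacian
    (hG : ∀ x, (G.neighborSet x).Finite) (h : V → ℝ) (h0 : ∀ x, 0 ≤ h x)
    (hfin : ∀ H, {x | h x < H}.Finite)
    (hΔ : ∀ x, -1 ≤ ∑ y ∈ (hG x).toFinset, (h x - h y)) : ¬ G.StochasticallyIncomplete := by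
  classical
  rintro ⟨t, ht, x, hlt⟩
  have key : ∀ H : ℝ, h x < H →
      ENNReal.ofReal (1 - (h x + t) / H) ≤ ∑' y, G.heatKernel t x y := by
    intro H hxH
    have hH : 0 < H := (h0 x).trans_lt hxH
    set D := (hfin H).toFinset with hD
    have hx : x ∈ D := by simpa [hD] using hxH
    have e : ∀ s : ℝ, ((fun y : D => 1 - (h y + t) / H) + s • fun _ : D => (1 / H : ℝ)) =
        fun y : D => (fun y : V => 1 - (h y + t - s) / H) y := by
      intro s; ext y; simp; ring
    -- The path `1 - (h + t - s) / H` is nonpositive outside `D`, where `h ≥ H` and `s ≤ t`, and is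
    -- at most `1` at its end `s = t`.
    have hcmp := Matrix.le_exp_mulVec_of_affine (M := -G.dirichletLaplacian D)
      (neg_dirichletLaplacian_apply_nonneg D) (fun y => 1 - (h y + t) / H) (fun _ => 1 / H) ht.le
      (fun s hs z => by
        rw [e, Matrix.neg_mulVec, Pi.neg_apply,
          dirichletLaplacian_mulVec hG D (fun y : V => 1 - (h y + t - s) / H) z]
        have h1 : -1 / H ≤ (∑ y ∈ (hG z).toFinset, (h z - h y)) / H :=
          div_le_div_of_nonneg_right (hΔ z) hH.le
        have h2 : ∑ y ∈ (hG z).toFinset, ((1 - (h z + t - s) / H) - (1 - (h y + t - s) / H)) =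
            -((∑ y ∈ (hG z).toFinset, (h z - h y)) / H) := by
          rw [Finset.sum_div, ← Finset.sum_neg_distrib]
          exact Finset.sum_congr rfl fun y _ => by ring
        have h3 : ∑ y ∈ (hG z).toFinset with y ∉ (D : Set V), (1 - (h y + t - s) / H) ≤ 0 := by
          refine Finset.sum_nonpos fun y hy => ?_
          have hy' : H ≤ h y := by simpa [hD] using (Finset.mem_filter.1 hy).2
          rw [sub_nonpos, one_le_div hH]
          linarith [hs.2]
        have h4 : -1 / H = -(1 / H) := by ring
        linarith) ⟨x, hx⟩
    rw [e, ← sum_dirichletHeatKernel_mul t hx (fun y : V => 1 - (h y + t - t) / H)] at hcmp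
    have h5 : ∑ y ∈ D, G.dirichletHeatKernel D t x y * (1 - (h y + t - t) / H) ≤
        ∑ y ∈ D, G.dirichletHeatKernel D t x y := by
      refine Finset.sum_le_sum fun y _ => mul_le_of_le_one_right
        (dirichletHeatKernel_nonneg D ht.le x y) ?_
      have : 0 ≤ (h y + t - t) / H := div_nonneg (by linarith [h0 y]) hH.le
      linarith
    calc ENNReal.ofReal (1 - (h x + t) / H)
        ≤ ENNReal.ofReal (∑ y ∈ D, G.dirichletHeatKernel D t x y) :=
          ENNReal.ofReal_le_ofReal (hcmp.trans h5)
      _ = ∑ y ∈ D, ENNReal.ofReal (G.dirichletHeatKernel D t x y) :=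
          ENNReal.ofReal_sum_of_nonneg fun y _ => dirichletHeatKernel_nonneg D ht.le x y
      _ ≤ ∑ y ∈ D, G.heatKernel t x y :=
          Finset.sum_le_sum fun y _ =>
            le_iSup (fun D : Finset V => ENNReal.ofReal (G.dirichletHeatKernel D t x y)) D
      _ ≤ _ := ENNReal.sum_le_tsum D
  have hlim : Filter.Tendsto (fun H : ℝ => ENNReal.ofReal (1 - (h x + t) / H)) Filter.atTop
      (nhds 1) := by
    have h1 : Filter.Tendsto (fun H : ℝ => 1 - (h x + t) / H) Filter.atTop (nhds (1 - 0)) :=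
      tendsto_const_nhds.sub (tendsto_const_nhds.div_atTop Filter.tendsto_id)
    simpa using ENNReal.tendsto_ofReal h1
  exact absurd (le_of_tendsto hlim ((Filter.eventually_gt_atTop (h x)).mono key)) (not_le.2 hlt)

end SimpleGraph

/-! ### Radial functions and the series criterion. -/

namespace SimpleGraph

variable {V : Type*} {G : SimpleGraph V} {x₀ : V}

/-- A neighbor lies in the same sphere or an adjacent one, and neighbors in the same sphere
contribute nothing. -/
theorem sum_neighbor_sub_of_radial {kp km : ℕ → ℕ} (hsym : G.IsSphericallySymmetricWith x₀ kp km)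
    (hG : ∀ x, (G.neighborSet x).Finite) (φ : ℕ → ℝ) (x : V) :
    ∑ y ∈ (hG x).toFinset, (φ (G.dist x x₀) - φ (G.dist y x₀)) =
      kp (G.dist x x₀) * (φ (G.dist x x₀) - φ (G.dist x x₀ + 1)) +
        km (G.dist x x₀) * (φ (G.dist x x₀) - φ (G.dist x x₀ - 1)) := by
  classical
  set r := G.dist x x₀ with hr
  have hp : ((hG x).toFinset.filter fun y => G.dist y x₀ = r + 1).card = kp r := by
    rw [← (hsym x).1, ← Set.ncard_coe_finset]
    congr 1
    ext y
    simp [hr]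
  have hm : ((hG x).toFinset.filter fun y => G.dist y x₀ + 1 = r).card = km r := by
    rw [← (hsym x).2, ← Set.ncard_coe_finset]
    congr 1
    ext y
    simp [hr]
  have hsplit : ∀ y ∈ (hG x).toFinset, φ r - φ (G.dist y x₀) =
      (if G.dist y x₀ = r + 1 then φ r - φ (r + 1) else 0) +
        if G.dist y x₀ + 1 = r then φ r - φ (r - 1) else 0 := by
    intro y hy
    have hadj : G.Adj x y := by simpa using hy
    have h := hadj.diff_dist_adj (u := x₀)
    rw [dist_comm (u := x₀) (v := x), dist_comm (u := x₀) (v := y), ← hr] at h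
    rcases h with h | h | h
    · rw [h, if_neg (by omega), if_neg (by omega)]; simp
    · rw [h, if_pos rfl, if_neg (by omega)]; simp
    -- At `r = 0` the truncated `r - 1` is `0`, so this case is again the same sphere.
    · rcases Nat.eq_zero_or_pos r with h' | h'
      · rw [h, if_neg (by omega), if_neg (by omega)]; simp [h']
      · rw [h, if_neg (by omega), if_pos (by omega)]; simp
  rw [Finset.sum_congr rfl hsplit, Finset.sum_add_distrib, ← Finset.sum_filter,
    ← Finset.sum_filter, Finset.sum_const, Finset.sum_const, hp, hm, nsmul_eq_mul, nsmul_eq_mul]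

/-- A graph in which consecutive spheres about `x₀` are completely joined is stochastically
incomplete if and only if the series `∑ V(r) / (S(r) S(r + 1))` converges. -/
theorem stochasticallyIncomplete_iff_summable {S : ℕ → ℕ} (hS : ∀ r, G.sphereArea x₀ r = S r)
    (hpos : ∀ r, 0 < S r) (hG : ∀ x, (G.neighborSet x).Finite)
    (hsym : G.IsSphericallySymmetricWith x₀ (fun r => S (r + 1))
      (fun r => if r = 0 then 0 else S (r - 1))) :
    G.StochasticallyIncomplete ↔
      Summable fun r : ℕ => (G.ballVolume x₀ r : ℝ) / ((S r : ℝ) * (S (r + 1) : ℝ)) := by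
  have hSR : ∀ r, (0 : ℝ) < S r := fun r => Nat.cast_pos.2 (hpos r)
  set a : ℕ → ℝ := fun r => (G.ballVolume x₀ r : ℝ) / ((S r : ℝ) * (S (r + 1) : ℝ)) with ha
  have ha0 : ∀ r, 0 ≤ a r := fun r => by positivity
  set P : ℕ → ℝ := fun n => ∑ i ∈ Finset.range n, a i with hP
  have hP0 : ∀ n, 0 ≤ P n := fun n => Finset.sum_nonneg fun i _ => ha0 i
  have hPs : ∀ n, P (n + 1) = P n + a n := fun n => Finset.sum_range_succ a n
  -- The outward differences add up to `-V(r) / S(r)` and the inward ones to `V(r-1) / S(r)`; the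
  -- sum is `-S(r) / S(r) = -1`.
  have hΔ : ∀ x, ∑ y ∈ (hG x).toFinset, (P (G.dist x x₀) - P (G.dist y x₀)) = -1 := by
    intro x
    rw [sum_neighbor_sub_of_radial hsym hG P x]
    have hflux : ∀ r, (S (r + 1) : ℝ) * a r = G.ballVolume x₀ r / S r := fun r => by
      have := (hSR r).ne'
      have := (hSR (r + 1)).ne'
      simp only [ha]
      field_simp
    rcases hr : G.dist x x₀ with _ | r
    · have h1 : (G.ballVolume x₀ 0 : ℝ) = S 0 := by simp [ballVolume, hS]
      have h2 := hflux 0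
      rw [h1, div_self (hSR 0).ne'] at h2
      simp only [hPs, if_true]
      push_cast
      linarith
    · have h1 : (G.ballVolume x₀ (r + 1) : ℝ) = G.ballVolume x₀ r + S (r + 1) := by
        rw [ballVolume, Finset.sum_range_succ, hS, ballVolume]; push_cast; rfl
      have h2 := hflux (r + 1)
      have h3 : (S r : ℝ) * a r = G.ballVolume x₀ r / S (r + 1) := by
        have := (hSR r).ne'
        have := (hSR (r + 1)).ne'
        simp only [ha]
        field_simp
      rw [h1, add_div, div_self (hSR (r + 1)).ne', ← h3] at h2
      simp only [Nat.add_sub_cancel, Nat.succ_ne_zero, if_false, hPs (r + 1), hPs r]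
      linarith
  constructor
  · intro hinc
    by_contra hns
    have htop : Filter.Tendsto P Filter.atTop Filter.atTop :=
      (not_summable_iff_tendsto_nat_atTop_of_nonneg ha0).1 hns
    refine not_stochasticallyIncomplete_of_neg_one_le_laplacian hG (fun x => P (G.dist x x₀))
      (fun x => hP0 _) (fun H => ?_) (fun x => (hΔ x).ge) hinc
    obtain ⟨N, hN⟩ := Filter.eventually_atTop.1 (htop.eventually_ge_atTop H)
    refine ((Set.finite_lt_nat N).biUnion (t := fun r => {x : V | G.dist x x₀ = r})
      fun r _ => Set.finite_of_ncard_pos ?_).subset fun x hx => ?_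
    -- An infinite set has `ncard` zero, so positive area forces the sphere to be finite.
    · exact (hpos r).trans_eq (hS r).symm
    · refine Set.mem_biUnion (x := G.dist x x₀) ?_ rfl
      by_contra hge
      exact absurd (hN _ (not_lt.1 hge)) (not_le.2 hx)
  · intro hsum
    have : Nonempty V := ⟨x₀⟩
    refine stochasticallyIncomplete_of_one_le_laplacian hG
      (fun x => (∑' r, a r) - P (G.dist x x₀))
      (fun x => sub_nonneg.2 (hsum.sum_le_tsum _ fun i _ => ha0 i)) fun x => ?_
    have h1 := hΔ x
    rw [← neg_inj, ← Finset.sum_neg_distrib, neg_neg] at h1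
    rw [← h1]
    exact Finset.sum_le_sum fun y _ => by linarith

/-! ### Spheres and distances to the root. -/

theorem Connected.exists_adj_dist_eq (hc : G.Connected) {x : V} {n : ℕ}
    (hx : G.dist x x₀ = n + 1) : ∃ y, G.Adj x y ∧ G.dist y x₀ = n := by
  obtain ⟨p, hp⟩ := hc.exists_walk_length_eq_dist x x₀
  cases p with
  | nil => simp at hx
  | @cons _ y _ hadj q =>
    refine ⟨y, hadj, ?_⟩
    have h1 := dist_le q
    have h2 := hc.dist_triangle (u := x) (v := y) (w := x₀)
    rw [dist_eq_one_iff_adj.2 hadj] at h2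
    rw [Walk.length_cons] at hp
    omega

theorem Connected.finite_sphere (hc : G.Connected) (hG : ∀ x, (G.neighborSet x).Finite) (r : ℕ) :
    {x : V | G.dist x x₀ = r}.Finite := by
  induction r with
  | zero => exact (Set.finite_singleton x₀).subset fun x hx => hc.dist_eq_zero_iff.1 hx
  | succ r ih =>
    refine (ih.biUnion fun x _ => hG x).subset fun x hx => ?_
    obtain ⟨y, hxy, hy⟩ := hc.exists_adj_dist_eq hx
    exact Set.mem_biUnion (x := y) hy hxy.symm

/-- An empty sphere leaves all later spheres empty, which would make `V` a finite union of finite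
spheres. -/
theorem Connected.sphereArea_pos [Infinite V] (hc : G.Connected)
    (hG : ∀ x, (G.neighborSet x).Finite) (r : ℕ) : 0 < G.sphereArea x₀ r := by
  rw [sphereArea, Set.ncard_pos (hc.finite_sphere hG r), Set.nonempty_iff_ne_empty]
  intro hempty
  have hfar : ∀ k, {x : V | G.dist x x₀ = r + k} = ∅ := by
    intro k
    induction k with
    | zero => exact hempty
    | succ k ih =>
      refine Set.eq_empty_of_forall_notMem fun x hx => ?_
      obtain ⟨y, -, hy⟩ := hc.exists_adj_dist_eq (show G.dist x x₀ = (r + k) + 1 from hx)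
      exact Set.eq_empty_iff_forall_notMem.1 ih y hy
  refine Set.infinite_univ (α := V) (((Set.finite_lt_nat r).biUnion
    fun i _ => hc.finite_sphere (x₀ := x₀) hG i).subset fun x _ => ?_)
  refine Set.mem_biUnion (x := G.dist x x₀) ?_ rfl
  by_contra hge
  obtain ⟨k, hk⟩ := Nat.exists_eq_add_of_le (not_lt.1 hge)
  exact Set.eq_empty_iff_forall_notMem.1 (hfar k) x hk

theorem Walk.le_add_length_of_layering {ρ : V → ℕ} (hadj : ∀ x y, G.Adj x y → ρ x ≤ ρ y + 1)
    {x y : V} (p : G.Walk x y) : ρ x ≤ ρ y + p.length := by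
  induction p with
  | nil => simp
  | cons h q ih =>
    have := hadj _ _ h
    rw [Walk.length_cons]
    omega

/-- A function that vanishes exactly at `x₀`, changes by at most `1` along edges, and decreases by
`1` along some edge at every other vertex, is the distance from `x₀`. -/
theorem connected_and_dist_eq_of_layering {ρ : V → ℕ} (h0 : ∀ x, ρ x = 0 ↔ x = x₀)
    (hadj : ∀ x y, G.Adj x y → ρ x ≤ ρ y + 1)
    (hpred : ∀ x n, ρ x = n + 1 → ∃ y, G.Adj x y ∧ ρ y = n) :
    G.Connected ∧ ∀ x, G.dist x x₀ = ρ x := by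
  have hwalk : ∀ n x, ρ x = n → ∃ p : G.Walk x x₀, p.length = n := by
    intro n
    induction n with
    | zero =>
      intro x hx
      obtain rfl := (h0 x).1 hx
      exact ⟨Walk.nil, rfl⟩
    | succ n ih =>
      intro x hx
      obtain ⟨y, hxy, hy⟩ := hpred x n hx
      obtain ⟨p, hp⟩ := ih y hy
      exact ⟨Walk.cons hxy p, by rw [Walk.length_cons, hp]⟩
  have hreach : ∀ x, G.Reachable x x₀ := fun x => ⟨(hwalk _ x rfl).choose⟩
  refine ⟨(connected_iff_exists_forall_reachable G).2 ⟨x₀, fun x => (hreach x).symm⟩, fun x => ?_⟩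
  obtain ⟨p, hp⟩ := hwalk _ x rfl
  obtain ⟨q, hq⟩ := (hreach x).exists_walk_length_eq_dist
  have h1 := dist_le p
  have h2 := q.le_add_length_of_layering hadj
  rw [(h0 x₀).2 rfl] at h2
  omega

end SimpleGraph

/-! ### Joining spheres and layered graphs. -/

namespace SimpleGraph

section JoinSpheres

variable {V : Type*} {G : SimpleGraph V} {x₀ : V}

/-- The added edges change the old distance by exactly one, so it still satisfies the layering
conditions in the new graph. -/
theorem Connected.joinSpheres_dist (hc : G.Connected) (x : V) :
    (G.joinSpheres x₀).dist x x₀ = G.dist x x₀ := by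
  refine (connected_and_dist_eq_of_layering (ρ := fun x => G.dist x x₀)
    (fun x => hc.dist_eq_zero_iff) (fun x y h => ?_) fun x n hx => ?_).2 x
  · rcases h with h | h | h
    · have h1 := hc.dist_triangle (u := x) (v := y) (w := x₀)
      rw [dist_eq_one_iff_adj.2 h] at h1
      omega
    · omega
    · omega
  · obtain ⟨y, hxy, hy⟩ := hc.exists_adj_dist_eq hx
    exact ⟨y, Or.inl hxy, hy⟩

theorem Connected.joinSpheres_sphereArea (hc : G.Connected) (r : ℕ) :
    (G.joinSpheres x₀).sphereArea x₀ r = G.sphereArea x₀ r := by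
  simp only [sphereArea, hc.joinSpheres_dist]

theorem Connected.joinSpheres_isSphericallySymmetricWith (hc : G.Connected) :
    (G.joinSpheres x₀).IsSphericallySymmetricWith x₀ (fun r => G.sphereArea x₀ (r + 1))
      (fun r => if r = 0 then 0 else G.sphereArea x₀ (r - 1)) := by
  intro x
  simp only [hc.joinSpheres_dist, sphereArea]
  constructor
  · congr 1
    ext y
    exact ⟨fun h => h.2, fun h => ⟨Or.inr (Or.inl h.symm), h⟩⟩
  · split_ifs with h0
    · simp [h0]
    · congr 1
      ext y
      simp only [Set.mem_ofPred_eq]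
      exact ⟨fun h => by omega, fun h => ⟨Or.inr (Or.inr (by omega)), by omega⟩⟩

theorem Connected.finite_neighborSet_joinSpheres (hc : G.Connected)
    (hG : ∀ x, (G.neighborSet x).Finite) (x : V) :
    ((G.joinSpheres x₀).neighborSet x).Finite := by
  refine ((hG x).union ((hc.finite_sphere (x₀ := x₀) hG (G.dist x x₀ + 1)).union
    (hc.finite_sphere (x₀ := x₀) hG (G.dist x x₀ - 1)))).subset fun y hy => ?_
  rcases hy with h | h | h
  · exact Or.inl h
  · exact Or.inr (Or.inl h.symm)
  · exact Or.inr (Or.inr (show G.dist y x₀ = G.dist x x₀ - 1 by omega))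

theorem Connected.joinSpheres_stochasticallyIncomplete [Infinite V] (hc : G.Connected)
    (hG : ∀ x, (G.neighborSet x).Finite)
    (hsum : Summable fun r : ℕ => (G.ballVolume x₀ r : ℝ) /
      ((G.sphereArea x₀ r : ℝ) * (G.sphereArea x₀ (r + 1) : ℝ))) :
    (G.joinSpheres x₀).StochasticallyIncomplete := by
  rw [stochasticallyIncomplete_iff_summable hc.joinSpheres_sphereArea (hc.sphereArea_pos hG)
    (hc.finite_neighborSet_joinSpheres hG) hc.joinSpheres_isSphericallySymmetricWith]
  simpa only [ballVolume, hc.joinSpheres_sphereArea] using hsum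

end JoinSpheres

section LayeredGraph

variable {S : ℕ → ℕ}

theorem layeredGraph_connected_and_dist (h0 : S 0 = 1) (hS : ∀ r, 0 < S r) :
    (layeredGraph S).Connected ∧ ∀ x, (layeredGraph S).dist x (layeredRoot S h0) = x.1 := by
  refine connected_and_dist_eq_of_layering (fun x => ⟨fun h => ?_, fun h => by rw [h]; rfl⟩)
    (fun x y h => ?_) fun x n hx => ⟨⟨n, 0, hS n⟩, Or.inr hx.symm, rfl⟩
  · obtain ⟨r, i, hi⟩ := x
    obtain rfl : r = 0 := h
    obtain rfl : i = 0 := by omega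
    rfl
  · rcases h with h | h <;> omega

theorem layeredGraph_dist (h0 : S 0 = 1) (hS : ∀ r, 0 < S r) (x : Σ r : ℕ, Fin (S r)) :
    (layeredGraph S).dist x (layeredRoot S h0) = x.1 :=
  (layeredGraph_connected_and_dist h0 hS).2 x

theorem layer_eq_range (r : ℕ) :
    {x : Σ r : ℕ, Fin (S r) | x.1 = r} = Set.range (Sigma.mk r) := by
  ext ⟨k, i⟩
  constructor
  · rintro rfl
    exact ⟨i, rfl⟩
  · rintro ⟨j, hj⟩
    exact (congrArg Sigma.fst hj).symm

theorem finite_layer (r : ℕ) : {x : Σ r : ℕ, Fin (S r) | x.1 = r}.Finite :=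
  layer_eq_range (S := S) r ▸ Set.finite_range _

theorem ncard_layer (r : ℕ) : {x : Σ r : ℕ, Fin (S r) | x.1 = r}.ncard = S r := by
  rw [layer_eq_range, ← Set.image_univ, Set.ncard_image_of_injective _ sigma_mk_injective,
    Set.ncard_univ, Nat.card_eq_fintype_card, Fintype.card_fin]

theorem layeredGraph_sphereArea (h0 : S 0 = 1) (hS : ∀ r, 0 < S r) (r : ℕ) :
    (layeredGraph S).sphereArea (layeredRoot S h0) r = S r := by
  simp only [sphereArea, layeredGraph_dist h0 hS, ncard_layer]

/-- The case `r = 0` is separate because truncated subtraction would give `S 0 = 1` inner neighbors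
to the root. -/
theorem layeredGraph_isSphericallySymmetricWith (h0 : S 0 = 1) (hS : ∀ r, 0 < S r) :
    (layeredGraph S).IsSphericallySymmetricWith (layeredRoot S h0)
      (fun r => S (r + 1)) (fun r => if r = 0 then 0 else S (r - 1)) := by
  intro x
  simp only [layeredGraph_dist h0 hS]
  constructor
  · rw [← ncard_layer (S := S) (x.1 + 1)]
    congr 1
    ext y
    exact ⟨fun h => h.2, fun h => ⟨Or.inl h.symm, h⟩⟩
  · split_ifs with hx
    · simp [hx]
    · rw [← ncard_layer (S := S) (x.1 - 1)]
      congr 1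
      ext y
      simp only [Set.mem_ofPred_eq]
      exact ⟨fun h => by omega, fun h => ⟨Or.inr (by omega), by omega⟩⟩

theorem layeredGraph_finite_neighborSet (x : Σ r : ℕ, Fin (S r)) :
    ((layeredGraph S).neighborSet x).Finite := by
  refine ((finite_layer (x.1 + 1)).union (finite_layer (x.1 - 1))).subset fun y hy => ?_
  rcases hy with h | h
  · exact Or.inl h.symm
  · exact Or.inr (show y.1 = x.1 - 1 by omega)

theorem layeredGraph_stochasticallyIncomplete_iff (h0 : S 0 = 1) (hS : ∀ r, 0 < S r) :
    (layeredGraph S).StochasticallyIncomplete ↔ Summable fun r : ℕ =>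
      ((layeredGraph S).ballVolume (layeredRoot S h0) r : ℝ) / ((S r : ℝ) * (S (r + 1) : ℝ)) :=
  stochasticallyIncomplete_iff_summable (layeredGraph_sphereArea h0 hS) hS
    layeredGraph_finite_neighborSet (layeredGraph_isSphericallySymmetricWith h0 hS)

theorem layeredGraph_ballVolume (h0 : S 0 = 1) (hS : ∀ r, 0 < S r) (r : ℕ) :
    (layeredGraph S).ballVolume (layeredRoot S h0) r = ∑ i ∈ Finset.range (r + 1), S i :=
  Finset.sum_congr rfl fun i _ => layeredGraph_sphereArea h0 hS i

end LayeredGraph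

/-! ### Cubic and quadratic layers, and Grigor'yan's condition. -/

theorem ballVolume_layeredGraph_cube (r : ℕ) :
    ((layeredGraph fun r => (r + 1) ^ 3).ballVolume
      (layeredRoot (fun r => (r + 1) ^ 3) rfl) r : ℝ) =
        ((r : ℝ) + 1) ^ 2 * ((r : ℝ) + 2) ^ 2 / 4 := by
  rw [layeredGraph_ballVolume rfl fun r => by positivity]
  induction r with
  | zero => norm_num
  | succ r ih =>
    rw [Finset.sum_range_succ, Nat.cast_add, ih]
    push_cast
    ring

theorem ballVolume_layeredGraph_sq (r : ℕ) :
    ((layeredGraph fun r => (r + 1) ^ 2).ballVolume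
      (layeredRoot (fun r => (r + 1) ^ 2) rfl) r : ℝ) =
        ((r : ℝ) + 1) * ((r : ℝ) + 2) * (2 * r + 3) / 6 := by
  rw [layeredGraph_ballVolume rfl fun r => by positivity]
  induction r with
  | zero => norm_num
  | succ r ih =>
    rw [Finset.sum_range_succ, Nat.cast_add, ih]
    push_cast
    ring

/-- Both the majorant for cubic layers and the series `∑ 1 / k₊(r)` for quadratic ones. -/
theorem summable_one_div_add_two_sq : Summable fun r : ℕ => 1 / ((r : ℝ) + 2) ^ 2 := by
  have h := (summable_nat_add_iff 2).2 (Real.summable_one_div_nat_pow.2 one_lt_two)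
  simpa using h

theorem layeredGraph_cube_stochasticallyIncomplete :
    (layeredGraph fun r => (r + 1) ^ 3).StochasticallyIncomplete := by
  rw [layeredGraph_stochasticallyIncomplete_iff rfl fun r => by positivity]
  -- The term equals `1 / (4 (r + 1) (r + 2))`.
  refine summable_one_div_add_two_sq.of_nonneg_of_le (fun r => by positivity) fun r => ?_
  rw [ballVolume_layeredGraph_cube]
  push_cast
  rw [div_le_div_iff₀ (by positivity) (by positivity)]
  have hr : (0 : ℝ) ≤ r := Nat.cast_nonneg r
  have e : (1 * (((r : ℝ) + 1) ^ 3 * ((r : ℝ) + 1 + 1) ^ 3)) -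
      ((r : ℝ) + 1) ^ 2 * ((r : ℝ) + 2) ^ 2 / 4 * ((r : ℝ) + 2) ^ 2 =
      ((r : ℝ) + 1) ^ 2 * ((r : ℝ) + 2) ^ 3 * (3 * r + 2) / 4 := by ring
  have : 0 ≤ ((r : ℝ) + 1) ^ 2 * ((r : ℝ) + 2) ^ 3 * (3 * r + 2) / 4 := by positivity
  linarith

theorem layeredGraph_sq_not_stochasticallyIncomplete :
    ¬ (layeredGraph fun r => (r + 1) ^ 2).StochasticallyIncomplete := by
  rw [layeredGraph_stochasticallyIncomplete_iff rfl fun r => by positivity]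
  intro hsum
  have h : Summable fun r : ℕ => 1 / (((r + 1 : ℕ) : ℝ)) := by
    -- Six times the term is `(2r + 3) / ((r + 1) (r + 2))`, which is at least `1 / (r + 1)`.
    refine (hsum.mul_left 6).of_nonneg_of_le (fun r => by positivity) fun r => ?_
    rw [ballVolume_layeredGraph_sq]
    push_cast
    rw [← mul_div_assoc, div_le_div_iff₀ (by positivity) (by positivity)]
    have e : 6 * (((r : ℝ) + 1) * ((r : ℝ) + 2) * (2 * r + 3) / 6) * ((r : ℝ) + 1) -
        1 * (((r : ℝ) + 1) ^ 2 * ((r : ℝ) + 1 + 1) ^ 2) =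
        ((r : ℝ) + 1) ^ 3 * ((r : ℝ) + 2) := by ring
    have : 0 ≤ ((r : ℝ) + 1) ^ 3 * ((r : ℝ) + 2) := by positivity
    linarith
  exact Real.not_summable_one_div_natCast ((summable_nat_add_iff 1).1 h)

/-- Polynomial volume growth implies Grigor'yan's condition. -/
theorem grigoryanVolumeCondition_of_le_pow {V : Type*} {G : SimpleGraph V} {x₀ : V} {d : ℕ}
    (h2 : ∀ r, 1 ≤ r → 2 ≤ G.ballVolume x₀ r) (h : ∀ r, G.ballVolume x₀ r ≤ (r + 2) ^ d) :
    G.GrigoryanVolumeCondition x₀ := by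
  rw [GrigoryanVolumeCondition, eq_top_iff]
  -- A lower bound for the integrand: `log V(r) ≤ d log (n + 2) ≤ d (n + 1) ≤ 2 (d + 1) r` with `n =
  -- ⌊r⌋₊` and `r > 1`. Using `d + 1` keeps the constant meaningful at `d = 0`.
  have hc : (0 : ℝ) < 1 / (2 * (d + 1)) := by positivity
  calc (⊤ : ℝ≥0∞) = ∫⁻ _ in Ioi (1 : ℝ), ENNReal.ofReal (1 / (2 * (d + 1))) := by
        rw [setLIntegral_const, Real.volume_Ioi, ENNReal.mul_top]
        simpa using hc
    _ ≤ _ := setLIntegral_mono' measurableSet_Ioi fun r hr => ENNReal.ofReal_le_ofReal ?_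
  have hr1 : (1 : ℝ) < r := hr
  set n := ⌊r⌋₊ with hn
  have hn1 : 1 ≤ n := Nat.le_floor (by exact_mod_cast hr1.le)
  have hnr : (n : ℝ) ≤ r := Nat.floor_le (by linarith)
  have hV2 : (2 : ℝ) ≤ G.ballVolume x₀ n := by exact_mod_cast h2 n hn1
  have hlog : 0 < Real.log (G.ballVolume x₀ n : ℝ) := Real.log_pos (by linarith)
  have hle : Real.log (G.ballVolume x₀ n : ℝ) ≤ d * (n + 1) := by
    calc Real.log (G.ballVolume x₀ n : ℝ) ≤ Real.log (((n : ℝ) + 2) ^ d) :=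
          Real.log_le_log (by linarith) (by exact_mod_cast h n)
      _ = d * Real.log ((n : ℝ) + 2) := Real.log_pow _ _
      _ ≤ d * (n + 1) := by
          refine mul_le_mul_of_nonneg_left ?_ (Nat.cast_nonneg d)
          linarith [Real.log_le_sub_one_of_pos (show (0 : ℝ) < n + 2 by positivity)]
  rw [div_le_div_iff₀ (by positivity) hlog, one_mul]
  have hd : (d : ℝ) * (n + 1) ≤ (d + 1) * (2 * r) :=
    mul_le_mul (by linarith) (by linarith) (by positivity) (by positivity)
  linarith

theorem layeredGraph_cube_grigoryanVolumeCondition :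
    (layeredGraph fun r => (r + 1) ^ 3).GrigoryanVolumeCondition
      (layeredRoot (fun r => (r + 1) ^ 3) rfl) := by
  refine grigoryanVolumeCondition_of_le_pow (d := 4) (fun r hr => ?_) fun r => ?_
  · have hr' : (1 : ℝ) ≤ r := by exact_mod_cast hr
    have h : (2 : ℝ) ≤ ((r : ℝ) + 1) ^ 2 * ((r : ℝ) + 2) ^ 2 / 4 := by
      have h1 : (2 : ℝ) ^ 2 ≤ ((r : ℝ) + 1) ^ 2 := pow_le_pow_left₀ (by norm_num) (by linarith) 2
      have h2 : (3 : ℝ) ^ 2 ≤ ((r : ℝ) + 2) ^ 2 := pow_le_pow_left₀ (by norm_num) (by linarith) 2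
      nlinarith
    rw [← ballVolume_layeredGraph_cube] at h
    exact_mod_cast h
  · have h : ((r : ℝ) + 1) ^ 2 * ((r : ℝ) + 2) ^ 2 / 4 ≤ ((r : ℝ) + 2) ^ 4 := by
      have h1 : ((r : ℝ) + 1) ^ 2 ≤ ((r : ℝ) + 2) ^ 2 :=
        pow_le_pow_left₀ (by positivity) (by linarith) 2
      have h2 : (0 : ℝ) ≤ ((r : ℝ) + 2) ^ 2 := by positivity
      nlinarith [mul_le_mul_of_nonneg_right h1 h2]
    rw [← ballVolume_layeredGraph_cube] at h
    exact_mod_cast h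

end SimpleGraph

theorem mainTheorem4 :
    -- the graphs `G_S`: spheres, spherical symmetry and the criterion
    (∀ (S : ℕ → ℕ) (h0 : S 0 = 1), (∀ r, 0 < S r) →
      (∀ r, (SimpleGraph.layeredGraph S).sphereArea (SimpleGraph.layeredRoot S h0) r = S r) ∧
      (SimpleGraph.layeredGraph S).IsSphericallySymmetricWith (SimpleGraph.layeredRoot S h0)
        (fun r => S (r + 1)) (fun r => if r = 0 then 0 else S (r - 1)) ∧
      ((SimpleGraph.layeredGraph S).StochasticallyIncomplete ↔
        Summable fun r : ℕ =>
          ((SimpleGraph.layeredGraph S).ballVolume (SimpleGraph.layeredRoot S h0) r : ℝ) /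
            ((S r : ℝ) * (S (r + 1) : ℝ)))) ∧
    -- cubic spheres: stochastically incomplete with polynomial volume growth
    ((SimpleGraph.layeredGraph fun r => (r + 1) ^ 3).StochasticallyIncomplete ∧
      ∀ r : ℕ,
        ((SimpleGraph.layeredGraph fun r => (r + 1) ^ 3).ballVolume
          (SimpleGraph.layeredRoot (fun r => (r + 1) ^ 3) rfl) r : ℝ) =
            ((r : ℝ) + 1) ^ 2 * ((r : ℝ) + 2) ^ 2 / 4) ∧
    -- Grigor'yan's volume criterion fails for graphs
    (¬ ∀ (V : Type) (G : SimpleGraph V) (x₀ : V), Infinite V → G.Connected →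
        (∀ x, (G.neighborSet x).Finite) → G.GrigoryanVolumeCondition x₀ →
          ¬ G.StochasticallyIncomplete) ∧
    -- quadratic spheres: `∑ 1 / k₊(r) < ∞`, but stochastically complete
    ((SimpleGraph.layeredGraph fun r => (r + 1) ^ 2).IsSphericallySymmetricWith
        (SimpleGraph.layeredRoot (fun r => (r + 1) ^ 2) rfl)
        (fun r => (r + 2) ^ 2) (fun r => r ^ 2) ∧
      (Summable fun r : ℕ => 1 / ((r : ℝ) + 2) ^ 2) ∧
      ¬ (SimpleGraph.layeredGraph fun r => (r + 1) ^ 2).StochasticallyIncomplete) ∧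
    -- joining consecutive spheres in an arbitrary graph
    (∀ (V : Type*) (G : SimpleGraph V) (x₀ : V), Infinite V → G.Connected →
      (∀ x, (G.neighborSet x).Finite) →
      (Summable fun r : ℕ =>
        (G.ballVolume x₀ r : ℝ) / ((G.sphereArea x₀ r : ℝ) * (G.sphereArea x₀ (r + 1) : ℝ))) →
      (∃ kp km : ℕ → ℕ, (G.joinSpheres x₀).IsSphericallySymmetricWith x₀ kp km) ∧
        (G.joinSpheres x₀).StochasticallyIncomplete) := by
  refine ⟨fun S h0 hS => ⟨SimpleGraph.layeredGraph_sphereArea h0 hS,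
      SimpleGraph.layeredGraph_isSphericallySymmetricWith h0 hS,
      SimpleGraph.layeredGraph_stochasticallyIncomplete_iff h0 hS⟩,
    ⟨SimpleGraph.layeredGraph_cube_stochasticallyIncomplete,
      SimpleGraph.ballVolume_layeredGraph_cube⟩, fun h => ?_,
    ⟨fun x => ?_, SimpleGraph.summable_one_div_add_two_sq,
      SimpleGraph.layeredGraph_sq_not_stochasticallyIncomplete⟩,
    fun V G x₀ _ hc hG hsum => ⟨⟨_, _, hc.joinSpheres_isSphericallySymmetricWith⟩,
      hc.joinSpheres_stochasticallyIncomplete hG hsum⟩⟩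
  · refine h _ (SimpleGraph.layeredGraph fun r => (r + 1) ^ 3)
      (SimpleGraph.layeredRoot (fun r => (r + 1) ^ 3) rfl) ?_
      (SimpleGraph.layeredGraph_connected_and_dist rfl fun r => by positivity).1
      SimpleGraph.layeredGraph_finite_neighborSet
      SimpleGraph.layeredGraph_cube_grigoryanVolumeCondition
      SimpleGraph.layeredGraph_cube_stochasticallyIncomplete
    exact Infinite.of_injective (fun r : ℕ => ⟨r, 0, by positivity⟩)
      fun r s hrs => congrArg Sigma.fst hrs
  · have h := SimpleGraph.layeredGraph_isSphericallySymmetricWith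
      (S := fun r => (r + 1) ^ 2) rfl (fun r => by positivity) x
    refine ⟨h.1, h.2.trans ?_⟩
    -- The formula `r ^ 2` absorbs the exceptional value at the root, since `0 ^ 2 = 0`.
    rcases (SimpleGraph.layeredGraph fun r => (r + 1) ^ 2).dist x
      (SimpleGraph.layeredRoot (fun r => (r + 1) ^ 2) rfl) with _ | n <;> simp
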